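/- Let the canonical cubulation of $\mathbb{R}^4$ be its decomposition into the translates of the unit cube $[0,1]^4$ by integer vectors, together with all faces of these cubes. A gridded surface is a subset $N\subset\mathbb{R}^4$ which, with the subspace topology, is a topological 2-manifold (without boundary) and which is contained in the 2-skeleton of the canonical cubulation. Let $N$ be a gridded surface with $0\in N$, and let its squared-star at $0$ be $\mathcal{F}(N)=N\cap\mathcal{C}^0$, where $\mathcal{C}^0$ is the union of all closed 2-faces of the cubulation that contain $0$. Say that $M\subset\mathbb{R}^4$ is topologically locally flat at $x\in M$ if there are an open neighbourhood $U$ of $x$ in $\mathbb{R}^4$ and a homeomorphism of pairs $(U,U\cap M)\cong(\operatorname{Int}\mathbb{B}^4,\operatorname{Int}\mathbb{B}^2)$, where $\mathbb{B}^2=\mathbb{B}^4\cap(\mathbb{R}^2\times\{0\})$ is the standard disk in the closed unit ball $\mathbb{B}^4$. Then $\mathcal{F}(N)$ is topologically locally flat at $0$, and so is $N$: near $0$ both pairs $(\mathbb{R}^4,\mathcal{F}(N))$ and $(\mathbb{R}^4,N)$ are homeomorphic to the standard open ball pair. Moreover, $\mathcal{F}(N)$ is topologically locally flat at each of its points lying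 in the open cube $(-1,1)^4$. -/

import Mathlib

/-- The face of the canonical cubulation of `ℝᵐ` with lowest vertex `z ∈ ℤᵐ` and set of free
coordinates `S`; it is a cube of dimension `S.card`. -/
def cubeFace {m : ℕ} (z : Fin m → ℤ) (S : Finset (Fin m)) : Set (EuclideanSpace ℝ (Fin m)) :=
  {x | (∀ i ∈ S, (z i : ℝ) ≤ x i ∧ x i ≤ (z i : ℝ) + 1) ∧ ∀ i ∉ S, x i = (z i : ℝ)}

/-- `F` is a `k`-dimensional face of the canonical cubulation of `ℝᵐ`. -/
def IsCubicalFace {m : ℕ} (k : ℕ) (F : Set (EuclideanSpace ℝ (Fin m))) : Prop :=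
  ∃ (z : Fin m → ℤ) (S : Finset (Fin m)), S.card = k ∧ F = cubeFace z S

/-- The `n`-skeleton of the canonical cubulation of `ℝᵐ`: the union of all faces of dimension
at most `n`. -/
def cubicalSkeleton (m n : ℕ) : Set (EuclideanSpace ℝ (Fin m)) :=
  {x | ∃ k ≤ n, ∃ F, IsCubicalFace k F ∧ x ∈ F}

/-- `N ⊆ ℝᵐ`, with the subspace topology, is a topological `n`-manifold (without boundary; it is
automatically Hausdorff and second countable) contained in the `n`-skeleton. -/
def IsCubicalManifold (n : ℕ) {m : ℕ} (N : Set (EuclideanSpace ℝ (Fin m))) : Prop :=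
  Nonempty (ChartedSpace (EuclideanSpace ℝ (Fin n)) N) ∧ N ⊆ cubicalSkeleton m n

/-- A gridded surface: a cubical manifold of dimension two in `ℝ⁴`. -/
def IsGriddedSurface (N : Set (EuclideanSpace ℝ (Fin 4))) : Prop :=
  IsCubicalManifold 2 N

/-- The union of all closed 2-faces of the canonical cubulation of `ℝ⁴` that contain `0`. -/
def starAtZero : Set (EuclideanSpace ℝ (Fin 4)) :=
  {x | ∃ F, IsCubicalFace 2 F ∧ (0 : EuclideanSpace ℝ (Fin 4)) ∈ F ∧ x ∈ F}

/-- The squared-star of `N` at `0`. -/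
def squaredStar (N : Set (EuclideanSpace ℝ (Fin 4))) : Set (EuclideanSpace ℝ (Fin 4)) :=
  N ∩ starAtZero

/-- The standard open `n`-ball inside the open unit ball of `ℝᵐ`: the points of the open unit
ball all of whose coordinates after the first `n` vanish. -/
def standardSubball (n m : ℕ) : Set (EuclideanSpace ℝ (Fin m)) :=
  {y | y ∈ Metric.ball (0 : EuclideanSpace ℝ (Fin m)) 1 ∧ ∀ i : Fin m, n ≤ (i : ℕ) → y i = 0}

/-- The `n`-dimensional set `M ⊆ ℝᵐ` is topologically locally flat at its point `x`: some open
neighbourhood `U` of `x` in `ℝᵐ` admits a homeomorphism of pairs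
`(U, U ∩ M) ≅ (Int 𝔹ᵐ, Int 𝔹ⁿ)`. -/
def IsLocallyFlatAt (n : ℕ) {m : ℕ} (M : Set (EuclideanSpace ℝ (Fin m)))
    (x : EuclideanSpace ℝ (Fin m)) : Prop :=
  x ∈ M ∧ ∃ U : Set (EuclideanSpace ℝ (Fin m)), IsOpen U ∧ x ∈ U ∧
    ∃ h : U ≃ₜ Metric.ball (0 : EuclideanSpace ℝ (Fin m)) 1,
      ∀ u : U, (u : EuclideanSpace ℝ (Fin m)) ∈ M ↔
        (h u : EuclideanSpace ℝ (Fin m)) ∈ standardSubball n m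

/-! Near `0` the 2-skeleton is the union of the quadrants spanned by two signed axes lying on
different coordinate lines. The eight signed axes, joined whenever they span a quadrant, form the
edge graph of the four-dimensional cross-polytope, so a union of quadrants is the cone over a
subgraph.

Two facts carry the proof. The first is invariance of domain in the plane: if two locally planar
sets share a point and one contains the other near it, they agree near it
(`eventually_mem_of_locallyPlanar`). Hence a surface fills every open quadrant that it enters in a
small ball, cannot stop at a half-axis, and agrees near `0` with any flat plane through `0` that it
contains there. So the graph of quadrants that it enters has an edge and no leaves, and therefore
contains a cycle.

The second is that the cone over any cycle is unknotted (`isFlatPlane_cone_of_isCycle`). Replacing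
two consecutive edges `a c`, `c b` by the chord `a b` is realized by a piecewise linear
homeomorphism of `ℝ⁴` fixing the other quadrants. Such moves reduce every cycle to `a, b, -a, -b`,
whose cone is a coordinate plane. That the surface has no quadrants beyond the cycle follows from
the first fact. -/

/-! ### Invariance of domain in the plane -/

open Metric Topology in
/-- Nonvanishing maps to `ℂ` that are joined by a nonvanishing homotopy have a continuous logarithm
together. -/
theorem exists_continuous_log_of_homotopy {A : Type*} [TopologicalSpace A]
    {F : unitInterval × A → ℂ} (hF : Continuous F) (hF0 : ∀ q, F q ≠ 0)
    {L : A → ℂ} (hL : Continuous L) (h0 : ∀ a, Complex.exp (L a) = F (0, a)) :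
    ∃ L' : A → ℂ, Continuous L' ∧ ∀ a, Complex.exp (L' a) = F (1, a) := by
  let H : C(unitInterval × A, {z : ℂ // z ≠ 0}) := ⟨fun q => ⟨F q, hF0 q⟩, by fun_prop⟩
  have H0 : ∀ a, H (0, a) = ⟨Complex.exp ((⟨L, hL⟩ : C(A, ℂ)) a), Complex.exp_ne_zero _⟩ :=
    fun a => Subtype.ext (h0 a).symm
  let G := Complex.isCoveringMap_exp.liftHomotopy H ⟨L, hL⟩ H0
  refine ⟨fun a => G (1, a), by fun_prop, fun a => ?_⟩
  have := congr_fun (Complex.isCoveringMap_exp.liftHomotopy_lifts H ⟨L, hL⟩ H0) (1, a)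
  exact congr_arg Subtype.val this

open Metric in
/-- An odd map from the circle to `ℂ ∖ {0}` has no continuous logarithm. -/
theorem not_exists_continuous_log_of_odd {g : sphere (0 : ℂ) 1 → ℂ}
    (hg : ∀ z, g (-z) = -g z) :
    ¬ ∃ L : sphere (0 : ℂ) 1 → ℂ, Continuous L ∧ ∀ z, Complex.exp (L z) = g z := by
  rintro ⟨L, hL, hLg⟩
  -- `L (-z) - L z` is an odd multiple of `πi`, constant because the circle is connected; yet it
  -- changes sign under `z ↦ -z`.
  have hodd : ∀ z, ∃ k : ℤ, L (-z) - L z = (2 * k + 1) * (Real.pi * Complex.I) := by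
    intro z
    have h : Complex.exp (L (-z)) = Complex.exp (L z + Real.pi * Complex.I) := by
      rw [Complex.exp_add, Complex.exp_pi_mul_I, hLg, hLg, hg]; ring
    obtain ⟨k, hk⟩ := Complex.exp_eq_exp_iff_exists_int.1 h
    exact ⟨k, by rw [hk]; ring⟩
  choose k hk using hodd
  have hpi : (Real.pi * Complex.I) ≠ 0 := by simp [Real.pi_ne_zero]
  have hconn : IsPreconnected (sphere (0 : ℂ) 1) :=
    isPreconnected_sphere (by simp [Complex.rank_real_complex]) 0 1
  have : PreconnectedSpace (sphere (0 : ℂ) 1) := Subtype.preconnectedSpace hconn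
  have hcont : Continuous k := by
    have h1 : Continuous fun z => ((L (-z) - L z) / (Real.pi * Complex.I)).re := by fun_prop
    have h2 : ∀ z, ((L (-z) - L z) / (Real.pi * Complex.I)).re = 2 * (k z : ℝ) + 1 := by
      intro z
      rw [hk, mul_div_assoc, div_self hpi]
      simp
    have h3 : Continuous fun z => (k z : ℝ) := by
      have : (fun z => (k z : ℝ))
          = fun z => (((L (-z) - L z) / (Real.pi * Complex.I)).re - 1) / 2 := by
        funext z; rw [h2]; ring
      rw [this]; fun_prop
    exact Int.isClosedEmbedding_coe_real.isInducing.continuous_iff.2 h3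
  let z₀ : sphere (0 : ℂ) 1 := ⟨1, by simp⟩
  have hkk : k z₀ = k (-z₀) := PreconnectedSpace.constant inferInstance hcont
  have e1 := hk z₀
  have e2 := hk (-z₀)
  rw [neg_neg, ← hkk] at e2
  have e3 : ((2 * k z₀ + 1 : ℤ) : ℂ) * (Real.pi * Complex.I) = 0 := by
    push_cast; linear_combination (-1 / 2 : ℂ) * e1 - (1 / 2 : ℂ) * e2
  rcases mul_eq_zero.1 e3 with h | h
  · have : 2 * k z₀ + 1 = 0 := by exact_mod_cast h
    omega
  · exact hpi h

-- If values `y` near `f 0` were missed, `f - y` would have a logarithm on the circle, since the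
-- circle contracts in the disk. Moving `y` to `f 0` off the image of the circle, and then spreading
-- the two arguments `z` and `0` to `z / 2` and `-z / 2`, would give a logarithm of an odd map.
open Metric Topology in
theorem image_closedBall_mem_nhds_of_injOn {f : ℂ → ℂ} (hf : ContinuousOn f (closedBall 0 1))
    (hinj : Set.InjOn f (closedBall 0 1)) : f '' closedBall 0 1 ∈ 𝓝 (f 0) := by
  have hsub : ∀ z : sphere (0 : ℂ) 1, ‖(z : ℂ)‖ = 1 := fun z => by simp
  have hS : IsClosed (f '' sphere 0 1) :=
    ((isCompact_sphere 0 1).image_of_continuousOn (hf.mono sphere_subset_closedBall)).isClosed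
  have h0S : f 0 ∉ f '' sphere 0 1 := by
    rintro ⟨z, hz, hz0⟩
    have := hinj (sphere_subset_closedBall hz) (by simp) hz0
    simp [this] at hz
  obtain ⟨δ, hδ, hball⟩ := Metric.isOpen_iff.1 hS.isOpen_compl _ h0S
  refine Filter.mem_of_superset (ball_mem_nhds _ hδ) fun y hy => ?_
  by_contra hyn
  have hcomp : ∀ {g : unitInterval × sphere (0 : ℂ) 1 → ℂ}, Continuous g → (∀ q, ‖g q‖ ≤ 1) →
      Continuous fun q => f (g q) := fun hg hb =>
    hf.comp_continuous hg fun q => by simpa using hb q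
  have L1 : ∃ L : sphere (0 : ℂ) 1 → ℂ, Continuous L ∧
      ∀ z, Complex.exp (L z) = f z - y := by
    have hb : ∀ q : unitInterval × sphere (0 : ℂ) 1, ‖((q.1 : ℝ) : ℂ) * q.2‖ ≤ 1 := fun q => by
      simpa [abs_of_nonneg q.1.2.1] using q.1.2.2
    have h0y : f 0 - y ≠ 0 := fun h => hyn ⟨0, by simp, sub_eq_zero.1 h⟩
    obtain ⟨L, hL, hL'⟩ := exists_continuous_log_of_homotopy
      (F := fun q : unitInterval × sphere (0 : ℂ) 1 => f (((q.1 : ℝ) : ℂ) * q.2) - y)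
      ((hcomp (by fun_prop) hb).sub continuous_const)
      (fun q h => hyn ⟨_, by simpa using hb q, sub_eq_zero.1 h⟩)
      (L := fun _ => Complex.log (f 0 - y)) continuous_const
      (fun a => by simp [Complex.exp_log h0y])
    exact ⟨L, hL, fun z => by simpa using hL' z⟩
  have L2 : ∃ L : sphere (0 : ℂ) 1 → ℂ, Continuous L ∧
      ∀ z, Complex.exp (L z) = f z - f 0 := by
    obtain ⟨L₁, hL₁, hL₁'⟩ := L1
    obtain ⟨L, hL, hL'⟩ := exists_continuous_log_of_homotopy
      (F := fun q : unitInterval × sphere (0 : ℂ) 1 => f q.2 - (y + ((q.1 : ℝ) : ℂ) * (f 0 - y)))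
      ((hcomp (by fun_prop) (fun q => by simp)).sub (by fun_prop))
      (fun q h => by
        refine hball (a := f q.2) ?_ ⟨q.2, q.2.2, rfl⟩
        rw [sub_eq_zero.1 h]
        have : y + ((q.1 : ℝ) : ℂ) * (f 0 - y) = AffineMap.lineMap y (f 0) (q.1 : ℝ) := by
          simp [AffineMap.lineMap_apply]; ring
        rw [this]
        exact (convex_ball (f 0) δ).lineMap_mem hy (mem_ball_self hδ) q.1.2)
      hL₁ (fun a => by simp [hL₁'])
    exact ⟨L, hL, fun z => by simpa using hL' z⟩
  have L3 : ∃ L : sphere (0 : ℂ) 1 → ℂ, Continuous L ∧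
      ∀ z : sphere (0 : ℂ) 1, Complex.exp (L z) = f (z / 2) - f (-(z / 2)) := by
    obtain ⟨L₁, hL₁, hL₁'⟩ := L2
    have hpos : ∀ q : unitInterval × sphere (0 : ℂ) 1, 0 < 1 + (q.1 : ℝ) := fun q => by
      linarith [q.1.2.1]
    have hne : ∀ q : unitInterval × sphere (0 : ℂ) 1, 1 + ((q.1 : ℝ) : ℂ) ≠ 0 := fun q => by
      exact_mod_cast (hpos q).ne'
    have hn : ∀ q : unitInterval × sphere (0 : ℂ) 1, ‖1 + ((q.1 : ℝ) : ℂ)‖ = 1 + (q.1 : ℝ) := by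
      intro q
      rw [← Complex.ofReal_one, ← Complex.ofReal_add, Complex.norm_real, Real.norm_eq_abs,
        abs_of_pos (hpos q)]
    have hb1 : ∀ q : unitInterval × sphere (0 : ℂ) 1, ‖(q.2 : ℂ) / (1 + ((q.1 : ℝ) : ℂ))‖ ≤ 1 := by
      intro q
      rw [norm_div, hn, hsub, div_le_one (hpos q)]
      linarith [q.1.2.1]
    have hb2 : ∀ q : unitInterval × sphere (0 : ℂ) 1,
        ‖-(((q.1 : ℝ) : ℂ) * q.2 / (1 + ((q.1 : ℝ) : ℂ)))‖ ≤ 1 := by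
      intro q
      rw [norm_neg, norm_div, hn, norm_mul, hsub, div_le_one (hpos q)]
      simp [abs_of_nonneg q.1.2.1]
    -- The two arguments always differ by `z`, so injectivity keeps the homotopy away from zero.
    obtain ⟨L, hL, hL'⟩ := exists_continuous_log_of_homotopy
      (F := fun q : unitInterval × sphere (0 : ℂ) 1 => f (q.2 / (1 + ((q.1 : ℝ) : ℂ)))
        - f (-(((q.1 : ℝ) : ℂ) * q.2 / (1 + ((q.1 : ℝ) : ℂ)))))
      ((hcomp (Continuous.div (by fun_prop) (by fun_prop) hne) hb1).sub
        (hcomp (Continuous.div (by fun_prop) (by fun_prop) hne).neg hb2))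
      (fun q h => by
        have h1 := hinj (by simpa using hb1 q) (by simpa using hb2 q) (sub_eq_zero.1 h)
        have h2 : (1 + ((q.1 : ℝ) : ℂ)) * q.2 = 0 := by
          have := hne q
          field_simp at h1
          linear_combination h1
        rcases mul_eq_zero.1 h2 with h3 | h3
        · exact hne q h3
        · have := hsub q.2
          rw [h3] at this
          simp at this)
      hL₁ (fun a => by simp [hL₁'])
    refine ⟨L, hL, fun z => ?_⟩
    rw [hL' z]
    norm_num
  refine not_exists_continuous_log_of_odd (g := fun z => f (z / 2) - f (-(z / 2))) ?_ L3
  intro z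
  have : ((-z : sphere (0 : ℂ) 1) : ℂ) = -(z : ℂ) := rfl
  simp only [this, neg_div, neg_neg]
  ring

open Topology Metric in
theorem Complex.image_mem_nhds_of_injOn {f : ℂ → ℂ} {W : Set ℂ} {p : ℂ} (hW : W ∈ 𝓝 p)
    (hf : ContinuousOn f W) (hinj : Set.InjOn f W) : f '' W ∈ 𝓝 (f p) := by
  obtain ⟨ε, hε, hεW⟩ := Metric.nhds_basis_closedBall.mem_iff.1 hW
  have hmaps : Set.MapsTo (fun z : ℂ => p + (ε : ℂ) * z) (closedBall 0 1) W := by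
    intro z hz
    apply hεW
    have : ‖z‖ ≤ 1 := by simpa using hz
    simpa [abs_of_pos hε] using mul_le_of_le_one_right hε.le this
  have hε' : (ε : ℂ) ≠ 0 := by exact_mod_cast hε.ne'
  have h := image_closedBall_mem_nhds_of_injOn (f := fun z => f (p + (ε : ℂ) * z))
    (hf.comp (by fun_prop) hmaps)
    (fun a ha b hb hab => by
      have := hinj (hmaps ha) (hmaps hb) hab
      simpa [hε'] using this)
  simp only [mul_zero, add_zero] at h
  refine Filter.mem_of_superset h ?_
  rintro _ ⟨z, hz, rfl⟩
  exact ⟨_, hmaps hz, rfl⟩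

open Topology in
/-- Invariance of domain in the plane. -/
theorem EuclideanSpace.image_mem_nhds_of_injOn
    {f : EuclideanSpace ℝ (Fin 2) → EuclideanSpace ℝ (Fin 2)} {W : Set (EuclideanSpace ℝ (Fin 2))}
    {p : EuclideanSpace ℝ (Fin 2)} (hW : W ∈ 𝓝 p) (hf : ContinuousOn f W)
    (hinj : Set.InjOn f W) : f '' W ∈ 𝓝 (f p) := by
  let e : ℂ ≃ₜ EuclideanSpace ℝ (Fin 2) :=
    Complex.orthonormalBasisOneI.repr.toHomeomorph
  have h := Complex.image_mem_nhds_of_injOn (f := e.symm ∘ f ∘ e) (W := e ⁻¹' W) (p := e.symm p)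
    (e.continuous.continuousAt.preimage_mem_nhds (by simpa using hW))
    (e.symm.continuous.comp_continuousOn (hf.comp e.continuous.continuousOn fun _ h => h))
    (fun a ha b hb hab => e.injective (hinj ha hb (e.symm.injective hab)))
  have h2 := e.symm.continuous.continuousAt.preimage_mem_nhds (x := f p) (by simpa using h)
  refine Filter.mem_of_superset h2 ?_
  rintro y ⟨z, hz, hzy⟩
  exact ⟨e z, hz, e.symm.injective hzy⟩

/-! ### Locally planar and locally compact subsets -/

open Topology in
/-- If one locally planar subset of a space is contained in another one near a common point, then
the two subsets agree near that point. -/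
theorem eventually_mem_of_locallyPlanar {X : Type*} [TopologicalSpace X] {A B : Set X} {p : X}
    (hA : p ∈ A) (hB : p ∈ B)
    (eA : OpenPartialHomeomorph A (EuclideanSpace ℝ (Fin 2))) (hpA : ⟨p, hA⟩ ∈ eA.source)
    (eB : OpenPartialHomeomorph B (EuclideanSpace ℝ (Fin 2))) (hpB : ⟨p, hB⟩ ∈ eB.source)
    (h : ∀ᶠ x in 𝓝 p, x ∈ A → x ∈ B) : ∀ᶠ x in 𝓝 p, x ∈ B → x ∈ A := by
  classical
  obtain ⟨V, hV, hVs⟩ := isOpen_induced_iff.1 eB.open_source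
  have hpV : p ∈ V := by
    have : (⟨p, hB⟩ : B) ∈ Subtype.val ⁻¹' V := hVs ▸ hpB
    exact this
  -- The inclusion of `A` into `B`, which makes sense only near `p`; the value `p` elsewhere is
  -- never used.
  let j : A → B := fun a => if ha : (a : X) ∈ B then ⟨a, ha⟩ else ⟨p, hB⟩
  have hj : ∀ a : A, (a : X) ∈ B → (j a : X) = a := fun a ha => by simp [j, ha]
  let T : Set X := {x | (x ∈ A → x ∈ B) ∧ x ∈ V}
  have hT : T ∈ 𝓝 p := h.and (hV.mem_nhds hpV)
  let W : Set (EuclideanSpace ℝ (Fin 2)) :=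
    eA.target ∩ (fun w => (eA.symm w : X)) ⁻¹' T
  have hW : W ∈ 𝓝 (eA ⟨p, hA⟩) := by
    refine Filter.inter_mem (eA.open_target.mem_nhds (eA.map_source hpA)) ?_
    have h1 : ContinuousAt (fun w => (eA.symm w : X)) (eA ⟨p, hA⟩) :=
      continuous_subtype_val.continuousAt.comp (eA.continuousAt_symm (eA.map_source hpA))
    refine h1.preimage_mem_nhds ?_
    rwa [eA.left_inv hpA]
  have hWB : ∀ w ∈ W, (eA.symm w : X) ∈ B := fun w hw => hw.2.1 (eA.symm w).2
  have hWs : ∀ w ∈ W, j (eA.symm w) ∈ eB.source := by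
    intro w hw
    rw [← hVs, Set.mem_preimage, hj _ (hWB w hw)]
    exact hw.2.2
  have hjc : ContinuousOn (fun w => j (eA.symm w)) W := by
    rw [IsInducing.subtypeVal.continuousOn_iff]
    refine ContinuousOn.congr (f := fun w => (eA.symm w : X)) ?_ fun w hw => hj _ (hWB w hw)
    exact continuous_subtype_val.comp_continuousOn
      (eA.continuousOn_symm.mono fun w hw => hw.1)
  have hg : ContinuousOn (fun w => eB (j (eA.symm w))) W :=
    eB.continuousOn.comp hjc hWs
  have hinj : Set.InjOn (fun w => eB (j (eA.symm w))) W := by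
    intro a ha b hb hab
    have h1 := eB.injOn (hWs a ha) (hWs b hb) hab
    have h2 : (eA.symm a : X) = eA.symm b := by
      rw [← hj _ (hWB a ha), ← hj _ (hWB b hb), h1]
    exact eA.symm.injOn ha.1 hb.1 (Subtype.ext h2)
  have himg := EuclideanSpace.image_mem_nhds_of_injOn hW hg hinj
  have hjp : j (eA.symm (eA ⟨p, hA⟩)) = ⟨p, hB⟩ := by
    rw [eA.left_inv hpA]; exact Subtype.ext (hj _ hB)
  simp only [hjp] at himg
  have h1 : ∀ᶠ b : B in 𝓝 ⟨p, hB⟩, (b : X) ∈ A := by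
    filter_upwards [(eB.continuousAt hpB).preimage_mem_nhds himg, eB.open_source.mem_nhds hpB]
      with b hb hbs
    obtain ⟨w, hw, hwb⟩ := hb
    rw [← eB.injOn (hWs w hw) hbs hwb, hj _ (hWB w hw)]
    exact (eA.symm w).2
  rw [eventually_nhds_subtype_iff B ⟨p, hB⟩ (fun x => x ∈ A)] at h1
  exact eventually_nhdsWithin_iff.1 h1

open Topology in
/-- A locally compact subset of a metric space is relatively closed in a small ball around each of
its points. -/
theorem exists_ball_inter_closure_subset {X : Type*} [MetricSpace X] {s : Set X}
    [LocallyCompactSpace s] {p : X} (hp : p ∈ s) :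
    ∃ r > 0, Metric.ball p r ∩ closure s ⊆ s := by
  obtain ⟨K, hK, hKp⟩ := exists_compact_mem_nhds (⟨p, hp⟩ : s)
  obtain ⟨U, hU, hUK⟩ := mem_nhds_induced Subtype.val _ _ |>.1 hKp
  obtain ⟨r, hr, hrU⟩ := Metric.mem_nhds_iff.1 hU
  refine ⟨r, hr, fun x hx => ?_⟩
  have hKc : IsClosed (Subtype.val '' K) := (hK.image continuous_subtype_val).isClosed
  have h1 : x ∈ closure (Metric.ball p r ∩ s) :=
    Metric.isOpen_ball.inter_closure hx
  have h2 : Metric.ball p r ∩ s ⊆ Subtype.val '' K := fun y hy =>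
    ⟨⟨y, hy.2⟩, hUK (hrU hy.1), rfl⟩
  obtain ⟨y, -, rfl⟩ := hKc.closure_subset_iff.2 h2 h1
  exact y.2

/-! ### Flat planes and flat germs -/

/-- A subset of `ℝ⁴` is a flat plane if a homeomorphism of `ℝ⁴` carries it onto the plane of the
first two coordinates. -/
def IsFlatPlane (X : Set (EuclideanSpace ℝ (Fin 4))) : Prop :=
  ∃ H : EuclideanSpace ℝ (Fin 4) ≃ₜ EuclideanSpace ℝ (Fin 4),
    ∀ x, x ∈ X ↔ ∀ i : Fin 4, 2 ≤ (i : ℕ) → H x i = 0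

open Topology in
/-- A subset of `ℝ⁴` has a flat germ at a point if it agrees with a flat plane near the point. -/
def HasFlatGerm (M : Set (EuclideanSpace ℝ (Fin 4))) (p : EuclideanSpace ℝ (Fin 4)) : Prop :=
  ∃ X, IsFlatPlane X ∧ ∀ᶠ x in 𝓝 p, x ∈ M ↔ x ∈ X

namespace IsFlatPlane

variable {X : Set (EuclideanSpace ℝ (Fin 4))}

theorem of_homeomorph {Y : Set (EuclideanSpace ℝ (Fin 4))} (hX : IsFlatPlane X)
    (S : EuclideanSpace ℝ (Fin 4) ≃ₜ EuclideanSpace ℝ (Fin 4)) (h : ∀ x, x ∈ Y ↔ S x ∈ X) :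
    IsFlatPlane Y := by
  obtain ⟨H, hH⟩ := hX
  exact ⟨S.trans H, fun x => by rw [h, hH]; rfl⟩

theorem nonempty_homeomorph (hX : IsFlatPlane X) :
    Nonempty (X ≃ₜ EuclideanSpace ℝ (Fin 2)) := by
  obtain ⟨H, hH⟩ := hX
  let φ : EuclideanSpace ℝ (Fin 2) → EuclideanSpace ℝ (Fin 4) := fun y => !₂[y 0, y 1, 0, 0]
  have hφ : Continuous φ := by
    refine (PiLp.continuous_toLp 2 _).comp (continuous_pi fun i => ?_)
    fin_cases i <;> simp <;> fun_prop
  have hφ2 : ∀ y, H.symm (φ y) ∈ X := by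
    intro y
    rw [hH, H.apply_symm_apply]
    intro i hi
    fin_cases i <;> simp [φ] at hi ⊢
  let ψ : EuclideanSpace ℝ (Fin 4) → EuclideanSpace ℝ (Fin 2) := fun x => !₂[x 0, x 1]
  have hψ : Continuous ψ := by
    refine (PiLp.continuous_toLp 2 _).comp (continuous_pi fun i => ?_)
    fin_cases i <;> simp <;> fun_prop
  refine ⟨{
    toFun := fun x => ψ (H x)
    invFun := fun y => ⟨H.symm (φ y), hφ2 y⟩
    left_inv := fun x => ?_
    right_inv := fun y => ?_
    continuous_toFun := hψ.comp (H.continuous.comp continuous_subtype_val)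
    continuous_invFun := (H.symm.continuous.comp hφ).subtype_mk _ }⟩
  · apply Subtype.ext
    have h := (hH x).1 x.2
    have h2 := h 2 (by norm_num)
    have h3 := h 3 (by norm_num)
    change H.symm (φ (ψ (H x))) = x
    rw [H.symm_apply_eq]
    ext i
    fin_cases i <;> simp [φ, ψ, h2, h3]
  · simp only [H.apply_symm_apply]
    ext i
    fin_cases i <;> simp [φ, ψ]

variable {N : Set (EuclideanSpace ℝ (Fin 4))} [ChartedSpace (EuclideanSpace ℝ (Fin 2)) N]
  {p : EuclideanSpace ℝ (Fin 4)}

open Topology in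
theorem eventually_mem_of_subset_surface (hX : IsFlatPlane X) (hpN : p ∈ N)
    (hpX : p ∈ X) (h : ∀ᶠ x in 𝓝 p, x ∈ X → x ∈ N) : ∀ᶠ x in 𝓝 p, x ∈ N → x ∈ X := by
  obtain ⟨e⟩ := hX.nonempty_homeomorph
  exact eventually_mem_of_locallyPlanar hpX hpN e.toOpenPartialHomeomorph (Set.mem_univ _)
    (chartAt _ ⟨p, hpN⟩) (mem_chart_source _ _) h

open Topology in
theorem eventually_mem_of_surface_subset (hX : IsFlatPlane X) (hpN : p ∈ N)
    (h : ∀ᶠ x in 𝓝 p, x ∈ N → x ∈ X) : ∀ᶠ x in 𝓝 p, x ∈ X → x ∈ N := by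
  obtain ⟨e⟩ := hX.nonempty_homeomorph
  exact eventually_mem_of_locallyPlanar hpN (h.self_of_nhds hpN) (chartAt _ ⟨p, hpN⟩)
    (mem_chart_source _ _) e.toOpenPartialHomeomorph (Set.mem_univ _) h

open Topology in
/-- A surface that contains a flat plane near one of its points has a flat germ there. -/
theorem hasFlatGerm_of_subset_surface (hX : IsFlatPlane X) (hpN : p ∈ N)
    (hpX : p ∈ X) (h : ∀ᶠ x in 𝓝 p, x ∈ X → x ∈ N) : HasFlatGerm N p :=
  ⟨X, hX, by
    filter_upwards [h, hX.eventually_mem_of_subset_surface hpN hpX h] with x h1 h2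
    exact ⟨h2, h1⟩⟩

end IsFlatPlane

-- The homeomorphism that straightens the plane is followed by a translation and a dilation taking a
-- small ball around `H p` to the unit ball. As `H p` lies in the coordinate plane, both preserve
-- that plane.
open Topology in
theorem HasFlatGerm.isLocallyFlatAt {M : Set (EuclideanSpace ℝ (Fin 4))}
    {p : EuclideanSpace ℝ (Fin 4)} (hM : HasFlatGerm M p) (hp : p ∈ M) :
    IsLocallyFlatAt 2 M p := by
  obtain ⟨X, ⟨H, hH⟩, h⟩ := hM
  have hpX : p ∈ X := h.self_of_nhds.1 hp
  have h' : ∀ᶠ y in 𝓝 (H p), H.symm y ∈ M ↔ H.symm y ∈ X := by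
    refine (H.symm.continuous.tendsto (H p)).eventually (p := fun y => y ∈ M ↔ y ∈ X) ?_
    rwa [H.symm_apply_apply]
  obtain ⟨r, hr, hball⟩ := Metric.eventually_nhds_iff_ball.1 h'
  let G : EuclideanSpace ℝ (Fin 4) ≃ₜ EuclideanSpace ℝ (Fin 4) :=
    H.trans ((Homeomorph.addRight (-H p)).trans (Homeomorph.smulOfNeZero r⁻¹ (inv_ne_zero hr.ne')))
  have hG : ∀ x, G x = r⁻¹ • (H x - H p) := fun x => by
    simp [G, sub_eq_add_neg]
  have hGb : ∀ x, G x ∈ Metric.ball 0 1 → H x ∈ Metric.ball (H p) r := by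
    intro x hx
    rw [hG, mem_ball_zero_iff, norm_smul, norm_inv, Real.norm_of_nonneg hr.le,
      inv_mul_lt_iff₀ hr, mul_one] at hx
    rwa [mem_ball_iff_norm]
  let k : G ⁻¹' Metric.ball 0 1 ≃ₜ (Metric.ball 0 1 : Set (EuclideanSpace ℝ (Fin 4))) :=
    G.subtype fun _ => Iff.rfl
  refine ⟨hp, G ⁻¹' Metric.ball 0 1, Metric.isOpen_ball.preimage G.continuous, ?_,
    k, fun u => ?_⟩
  · simp [hG]
  · have h1 := hball _ (hGb u u.2)
    rw [H.symm_apply_apply] at h1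
    rw [h1, hH]
    have h2 : (k u : EuclideanSpace ℝ (Fin 4)) = G u := rfl
    rw [h2]
    have h3 : ∀ i : Fin 4, 2 ≤ (i : ℕ) → (H u i = 0 ↔ G u i = 0) := by
      intro i hi
      rw [hG]
      simp [(hH p).1 hpX i hi, hr.ne']
    exact ⟨fun hu => ⟨u.2, fun i hi => (h3 i hi).1 (hu i hi)⟩,
      fun hu i hi => (h3 i hi).2 (hu.2 i hi)⟩

/-! ### Signed axes and quadrants -/

/-- A coordinate axis of `ℝ⁴` together with an orientation of it. -/
abbrev SignedAxis : Type := Fin 4 × Bool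

namespace SignedAxis

/-- The sign of the orientation. -/
def sign (a : SignedAxis) : ℝ := if a.2 then 1 else -1

/-- The same axis with the other orientation. -/
def opp (a : SignedAxis) : SignedAxis := (a.1, !a.2)

/-- The coordinate along a signed axis. -/
noncomputable def coord (a : SignedAxis) : EuclideanSpace ℝ (Fin 4) →L[ℝ] ℝ :=
  a.sign • EuclideanSpace.proj a.1

/-- The unit vector along a signed axis. -/
noncomputable def unit (a : SignedAxis) : EuclideanSpace ℝ (Fin 4) :=
  EuclideanSpace.single a.1 a.sign

/-- The closed quadrant spanned by two signed axes. -/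
def quadrant (a b : SignedAxis) : Set (EuclideanSpace ℝ (Fin 4)) :=
  {x | 0 ≤ a.coord x ∧ 0 ≤ b.coord x ∧ ∀ i, i ≠ a.1 → i ≠ b.1 → x i = 0}

variable {a b c : SignedAxis}

theorem sign_eq_or (a : SignedAxis) : a.sign = 1 ∨ a.sign = -1 := by
  rcases a with ⟨i, _ | _⟩ <;> simp [sign]

theorem sign_mul_self (a : SignedAxis) : a.sign * a.sign = 1 := by
  rcases a.sign_eq_or with h | h <;> simp [h]

theorem coord_apply (a : SignedAxis) (x : EuclideanSpace ℝ (Fin 4)) :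
    a.coord x = a.sign * x a.1 := rfl

theorem coord_opp (a : SignedAxis) (x : EuclideanSpace ℝ (Fin 4)) :
    a.opp.coord x = -a.coord x := by
  rcases a with ⟨i, _ | _⟩ <;> simp [coord_apply, sign, opp]

@[simp] theorem opp_fst (a : SignedAxis) : a.opp.1 = a.1 := rfl

@[simp] theorem opp_opp (a : SignedAxis) : a.opp.opp = a := by simp [opp]

theorem opp_ne (a : SignedAxis) : a.opp ≠ a := by
  rcases a with ⟨i, _ | _⟩ <;> simp [opp]

theorem eq_opp_of_fst_eq (h : a.1 = b.1) (hab : a ≠ b) : a = b.opp := by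
  rcases a with ⟨i, _ | _⟩ <;> rcases b with ⟨j, _ | _⟩ <;> simp_all [opp]

@[simp] theorem coord_unit_self (a : SignedAxis) : a.coord a.unit = 1 := by
  simp [coord_apply, unit, sign_mul_self]

theorem coord_unit_of_ne (h : a.1 ≠ b.1) : a.coord b.unit = 0 := by
  simp [coord_apply, unit, h]

theorem unit_apply (a : SignedAxis) (i : Fin 4) : a.unit i = if i = a.1 then a.sign else 0 := by
  simp [unit]

theorem apply_eq_sign_mul_coord (a : SignedAxis) (x : EuclideanSpace ℝ (Fin 4)) :
    x a.1 = a.sign * a.coord x := by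
  rw [coord_apply, ← mul_assoc, sign_mul_self, one_mul]

theorem coord_eq_zero_iff (a : SignedAxis) (x : EuclideanSpace ℝ (Fin 4)) :
    a.coord x = 0 ↔ x a.1 = 0 := by
  rcases a.sign_eq_or with h | h <;> simp [coord_apply, h]

theorem exists_coord_pos {x : EuclideanSpace ℝ (Fin 4)} {i : Fin 4} (h : x i ≠ 0) :
    ∃ a : SignedAxis, a.1 = i ∧ 0 < a.coord x := by
  rcases lt_or_gt_of_ne h with h | h
  · exact ⟨(i, false), rfl, by simpa [coord_apply, sign] using h⟩
  · exact ⟨(i, true), rfl, by simpa [coord_apply, sign] using h⟩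

theorem quadrant_comm (a b : SignedAxis) : quadrant a b = quadrant b a := by
  ext x
  exact ⟨fun h => ⟨h.2.1, h.1, fun i hi hj => h.2.2 i hj hi⟩,
    fun h => ⟨h.2.1, h.1, fun i hi hj => h.2.2 i hj hi⟩⟩

theorem mem_quadrant_iff (hab : a.1 ≠ b.1) {x : EuclideanSpace ℝ (Fin 4)} :
    x ∈ quadrant a b ↔ ∃ s t : ℝ, 0 ≤ s ∧ 0 ≤ t ∧ x = s • a.unit + t • b.unit := by
  constructor
  · rintro ⟨ha, hb, h⟩
    refine ⟨a.coord x, b.coord x, ha, hb, ?_⟩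
    ext i
    by_cases hi : i = a.1
    · subst hi
      simp [unit_apply, hab, apply_eq_sign_mul_coord, mul_comm]
    · by_cases hi' : i = b.1
      · subst hi'
        simp [unit_apply, hab.symm, apply_eq_sign_mul_coord, mul_comm]
      · simp [unit_apply, hi, hi', h i hi hi']
  · rintro ⟨s, t, hs, ht, rfl⟩
    refine ⟨?_, ?_, fun i hi hi' => ?_⟩
    · simpa [coord_unit_of_ne hab] using hs
    · simpa [coord_unit_of_ne hab.symm] using ht
    · simp [unit_apply, hi, hi']

/-- The axis `c` is either opposite to one of `a`, `b` or orthogonal to both. This places the other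
quadrants in the region that the triangle move fixes. -/
theorem coord_nonpos_of_mem_quadrant (hca : c ≠ a) (hcb : c ≠ b)
    {x : EuclideanSpace ℝ (Fin 4)} (hx : x ∈ quadrant a b) : c.coord x ≤ 0 := by
  by_cases h1 : c.1 = a.1
  · rw [eq_opp_of_fst_eq h1 hca, coord_opp]
    linarith [hx.1]
  · by_cases h2 : c.1 = b.1
    · rw [eq_opp_of_fst_eq h2 hcb, coord_opp]
      linarith [hx.2.1]
    · rw [(coord_eq_zero_iff c x).2 (hx.2.2 _ h1 h2)]

end SignedAxis

/-! ### The triangle move -/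

/-- The map that moves each point along a fixed direction by an amount that does not change in this
direction. -/
def Homeomorph.shear {E : Type*} [AddCommGroup E] [Module ℝ E] [TopologicalSpace E]
    [IsTopologicalAddGroup E] [ContinuousSMul ℝ E] (f : E → ℝ) (hf : Continuous f) (v : E)
    (h : ∀ x (t : ℝ), f (x + t • v) = f x) : E ≃ₜ E where
  toFun x := x + f x • v
  invFun x := x + (-f x) • v
  left_inv x := by simp [h]
  right_inv x := by simp only [h]; simp
  continuous_toFun := by fun_prop
  continuous_invFun := by fun_prop

namespace SignedAxis

variable {a b c : SignedAxis}

/-- The homeomorphism that pushes the quadrants of `a, c` and of `c, b` onto the quadrant of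
`a, b`. -/
noncomputable def triangleHomeomorph (hac : a.1 ≠ c.1) (hbc : b.1 ≠ c.1) :
    EuclideanSpace ℝ (Fin 4) ≃ₜ EuclideanSpace ℝ (Fin 4) :=
  (Homeomorph.shear (fun x => max (c.coord x) 0) (by fun_prop) (a.unit + b.unit)
    (fun x t => by simp [coord_unit_of_ne hac.symm, coord_unit_of_ne hbc.symm])).trans
  (Homeomorph.shear (fun x => -max (min (a.coord x) (b.coord x)) 0) (by fun_prop) c.unit
    (fun x t => by simp [coord_unit_of_ne hac, coord_unit_of_ne hbc]))

theorem triangleHomeomorph_apply (hab : a.1 ≠ b.1) (hac : a.1 ≠ c.1) (hbc : b.1 ≠ c.1)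
    (x : EuclideanSpace ℝ (Fin 4)) :
    triangleHomeomorph hac hbc x =
      x + max (c.coord x) 0 • (a.unit + b.unit)
        - max (min (a.coord x + max (c.coord x) 0) (b.coord x + max (c.coord x) 0)) 0 • c.unit := by
  simp [triangleHomeomorph, Homeomorph.shear, coord_unit_of_ne hab, coord_unit_of_ne hab.symm,
    sub_eq_add_neg]

theorem triangleHomeomorph_apply_of_nonpos (hab : a.1 ≠ b.1) (hac : a.1 ≠ c.1)
    (hbc : b.1 ≠ c.1) {x : EuclideanSpace ℝ (Fin 4)} (hc : c.coord x ≤ 0)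
    (h : a.coord x ≤ 0 ∨ b.coord x ≤ 0) : triangleHomeomorph hac hbc x = x := by
  rw [triangleHomeomorph_apply hab hac hbc, max_eq_right hc]
  simp only [add_zero, zero_smul]
  rw [max_eq_right (min_le_iff.2 h)]
  simp

/-- The first shear raises both the `a` and `b` coordinates by `t`; their minimum is then `t`, and
the second shear cancels the `c` coordinate. The images form the half of the quadrant of `a, b`
where the `a` coordinate dominates; `triangleHomeomorph_right` gives the other half. -/
theorem triangleHomeomorph_left (hab : a.1 ≠ b.1) (hac : a.1 ≠ c.1) (hbc : b.1 ≠ c.1)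
    {s t : ℝ} (hs : 0 ≤ s) (ht : 0 ≤ t) :
    triangleHomeomorph hac hbc (s • a.unit + t • c.unit) =
      (s + t) • a.unit + t • b.unit := by
  rw [triangleHomeomorph_apply hab hac hbc]
  simp only [map_add, map_smul, coord_unit_self, coord_unit_of_ne hac.symm, coord_unit_of_ne hac,
    coord_unit_of_ne hbc, coord_unit_of_ne hab.symm, smul_eq_mul, mul_zero, mul_one, zero_add,
    add_zero, max_eq_left ht]
  rw [min_eq_right (by linarith), max_eq_left ht]
  module

theorem triangleHomeomorph_right (hab : a.1 ≠ b.1) (hac : a.1 ≠ c.1) (hbc : b.1 ≠ c.1)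
    {s t : ℝ} (hs : 0 ≤ s) (ht : 0 ≤ t) :
    triangleHomeomorph hac hbc (t • c.unit + s • b.unit) =
      t • a.unit + (s + t) • b.unit := by
  rw [triangleHomeomorph_apply hab hac hbc]
  simp only [map_add, map_smul, coord_unit_self, coord_unit_of_ne hbc.symm, coord_unit_of_ne hac,
    coord_unit_of_ne hbc, coord_unit_of_ne hab, smul_eq_mul, mul_zero, mul_one, zero_add,
    add_zero, max_eq_left ht]
  rw [min_eq_left (by linarith), max_eq_left ht]
  module

theorem isFlatPlane_triangle_iff (hab : a.1 ≠ b.1) (hac : a.1 ≠ c.1) (hbc : b.1 ≠ c.1)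
    {R : Set (EuclideanSpace ℝ (Fin 4))}
    (hR : ∀ x ∈ R, c.coord x ≤ 0 ∧ (a.coord x ≤ 0 ∨ b.coord x ≤ 0)) :
    IsFlatPlane (R ∪ (quadrant a c ∪ quadrant c b)) ↔ IsFlatPlane (R ∪ quadrant a b) := by
  have key : ∀ x, x ∈ R ∪ (quadrant a c ∪ quadrant c b) ↔
      triangleHomeomorph hac hbc x ∈ R ∪ quadrant a b := by
    intro x
    constructor
    · rintro (hx | hx | hx)
      · left
        rwa [triangleHomeomorph_apply_of_nonpos hab hac hbc (hR x hx).1 (hR x hx).2]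
      · obtain ⟨s, t, hs, ht, rfl⟩ := (mem_quadrant_iff hac).1 hx
        right
        rw [triangleHomeomorph_left hab hac hbc hs ht]
        exact (mem_quadrant_iff hab).2 ⟨_, _, by positivity, ht, rfl⟩
      · obtain ⟨t, s, ht, hs, rfl⟩ := (mem_quadrant_iff hbc.symm).1 hx
        right
        rw [triangleHomeomorph_right hab hac hbc hs ht]
        exact (mem_quadrant_iff hab).2 ⟨_, _, ht, by positivity, rfl⟩
    · generalize hy : triangleHomeomorph hac hbc x = y
      rintro (hyR | hyQ)
      · rw [← triangleHomeomorph_apply_of_nonpos hab hac hbc (hR y hyR).1 (hR y hyR).2] at hy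
        left
        rwa [(triangleHomeomorph hac hbc).injective hy]
      · obtain ⟨s, t, hs, ht, rfl⟩ := (mem_quadrant_iff hab).1 hyQ
        right
        rcases le_total t s with hst | hst
        · have h := triangleHomeomorph_left hab hac hbc (sub_nonneg.2 hst) ht
          rw [sub_add_cancel, ← hy] at h
          left
          rw [← (triangleHomeomorph hac hbc).injective h]
          exact (mem_quadrant_iff hac).2 ⟨_, _, sub_nonneg.2 hst, ht, rfl⟩
        · have h := triangleHomeomorph_right hab hac hbc (sub_nonneg.2 hst) hs
          rw [sub_add_cancel, ← hy] at h
          right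
          rw [← (triangleHomeomorph hac hbc).injective h]
          exact (mem_quadrant_iff hbc.symm).2 ⟨_, _, hs, sub_nonneg.2 hst, rfl⟩
  refine ⟨fun h => h.of_homeomorph (triangleHomeomorph hac hbc).symm fun x => ?_,
    fun h => h.of_homeomorph _ key⟩
  rw [key, Homeomorph.apply_symm_apply]

theorem isFlatPlane_coordinatePlane {i j : Fin 4} (hij : i ≠ j) :
    IsFlatPlane {x | ∀ k, k ≠ i → k ≠ j → x k = 0} := by
  obtain ⟨σ, h0, h1⟩ : ∃ σ : Equiv.Perm (Fin 4), σ 0 = i ∧ σ 1 = j := by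
    revert i j; decide
  let H := (LinearIsometryEquiv.piLpCongrLeft 2 ℝ ℝ σ.symm).toHomeomorph
  refine ⟨H, fun x => ?_⟩
  have hH : ∀ k, H x k = x (σ k) := fun k => by
    simp [H, LinearIsometryEquiv.piLpCongrLeft_apply, Equiv.piCongrLeft']
  simp only [Set.mem_ofPred_eq, hH]
  constructor
  · intro hx k hk
    refine hx _ ?_ ?_
    · rw [← h0, σ.injective.ne_iff]; rintro rfl; simp at hk
    · rw [← h1, σ.injective.ne_iff]; rintro rfl; simp at hk
  · intro hx k hki hkj
    rw [← σ.apply_symm_apply k]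
    refine hx _ ?_
    have e0 : σ.symm k ≠ 0 := fun h => hki (by rw [← h0, ← h, σ.apply_symm_apply])
    have e1 : σ.symm k ≠ 1 := fun h => hkj (by rw [← h1, ← h, σ.apply_symm_apply])
    generalize σ.symm k = l at *
    fin_cases l <;> simp_all

end SignedAxis

/-! ### Cones over cycles of quadrants -/

namespace SignedAxis

variable {a b c d : SignedAxis}

/-- The graph of the pairs of signed axes that span a quadrant. -/
def axisGraph : SimpleGraph SignedAxis where
  Adj a b := a.1 ≠ b.1
  symm := ⟨fun _ _ h => h.symm⟩
  loopless := ⟨fun _ h => h rfl⟩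

/-- The union of the quadrants that belong to a list of pairs of signed axes. -/
def cone (es : List (Sym2 SignedAxis)) : Set (EuclideanSpace ℝ (Fin 4)) :=
  {x | ∃ a b, s(a, b) ∈ es ∧ x ∈ quadrant a b}

theorem cone_cons (es : List (Sym2 SignedAxis)) :
    cone (s(a, b) :: es) = cone es ∪ quadrant a b := by
  ext x
  constructor
  · rintro ⟨a', b', h, hx⟩
    rcases List.mem_cons.1 h with h | h
    · right
      rcases Sym2.eq_iff.1 h with ⟨rfl, rfl⟩ | ⟨rfl, rfl⟩
      · exact hx
      · rwa [quadrant_comm]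
    · exact Or.inl ⟨a', b', h, hx⟩
  · rintro (⟨a', b', h, hx⟩ | hx)
    · exact ⟨a', b', List.mem_cons_of_mem _ h, hx⟩
    · exact ⟨a, b, List.mem_cons_self, hx⟩

theorem cone_congr {es es' : List (Sym2 SignedAxis)} (h : ∀ e, e ∈ es ↔ e ∈ es') :
    cone es = cone es' := by
  simp [cone, h]

/-- A remaining quadrant avoids `c` and at least one of `a`, `b`, so the corresponding coordinates
are nonpositive on it and the move fixes it. -/
theorem isFlatPlane_cone_triangle_iff (hab : a.1 ≠ b.1) (hac : a.1 ≠ c.1) (hbc : b.1 ≠ c.1)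
    {es : List (Sym2 SignedAxis)} (hc : ∀ e ∈ es, c ∉ e) (habe : s(a, b) ∉ es) :
    IsFlatPlane (cone (s(a, c) :: s(c, b) :: es)) ↔ IsFlatPlane (cone (s(a, b) :: es)) := by
  rw [cone_cons, cone_cons, cone_cons, Set.union_assoc, Set.union_comm (quadrant c b)]
  refine isFlatPlane_triangle_iff hab hac hbc ?_
  rintro x ⟨a', b', he, hx⟩
  have h1 := hc _ he
  simp only [Sym2.mem_iff, not_or] at h1
  refine ⟨coord_nonpos_of_mem_quadrant h1.1 h1.2 hx, ?_⟩
  by_cases ha : a ∈ s(a', b')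
  · right
    have hb : b ∉ s(a', b') := fun hb => habe <| by
      rwa [← (Sym2.mem_and_mem_iff (fun h => hab (by rw [h]))).1 ⟨ha, hb⟩]
    simp only [Sym2.mem_iff, not_or] at hb
    exact coord_nonpos_of_mem_quadrant hb.1 hb.2 hx
  · left
    simp only [Sym2.mem_iff, not_or] at ha
    exact coord_nonpos_of_mem_quadrant ha.1 ha.2 hx

theorem cone_opp_eq_coordinatePlane (a b : SignedAxis) :
    cone [s(a, b), s(b, a.opp), s(a.opp, b.opp), s(b.opp, a)] =
      {x | ∀ k, k ≠ a.1 → k ≠ b.1 → x k = 0} := by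
  ext x
  constructor
  · rintro ⟨a', b', h, hx⟩ k hka hkb
    have h1 : (a'.1 = a.1 ∨ a'.1 = b.1) ∧ (b'.1 = a.1 ∨ b'.1 = b.1) := by
      simp only [List.mem_cons, Sym2.eq_iff, List.not_mem_nil, or_false] at h
      rcases h with (⟨rfl, rfl⟩ | ⟨rfl, rfl⟩) | (⟨rfl, rfl⟩ | ⟨rfl, rfl⟩) |
        (⟨rfl, rfl⟩ | ⟨rfl, rfl⟩) | (⟨rfl, rfl⟩ | ⟨rfl, rfl⟩) <;> simp
    refine hx.2.2 k ?_ ?_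
    · rintro rfl; tauto
    · rintro rfl; tauto
  · intro hx
    have hx' : ∀ k, k ≠ b.1 → k ≠ a.1 → x k = 0 := fun k h1 h2 => hx k h2 h1
    rcases le_total 0 (a.coord x) with ha | ha <;> rcases le_total 0 (b.coord x) with hb | hb
    · exact ⟨a, b, by simp, ha, hb, hx⟩
    · exact ⟨b.opp, a, by simp, by rw [coord_opp]; linarith, ha, hx'⟩
    · exact ⟨b, a.opp, by simp, hb, by rw [coord_opp]; linarith, hx'⟩
    · exact ⟨a.opp, b.opp, by simp, by rw [coord_opp]; linarith, by rw [coord_opp]; linarith, hx⟩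

theorem isFlatPlane_cone_opp (hab : a.1 ≠ b.1) :
    IsFlatPlane (cone [s(a, b), s(b, a.opp), s(a.opp, b.opp), s(b.opp, a)]) := by
  rw [cone_opp_eq_coordinatePlane]
  exact isFlatPlane_coordinatePlane hab

/-- A triangle has no chord, so it is first enlarged: `a b c` becomes `a c' b c`, then `a c' b a'
c`, with primes for opposites. Dropping `b` leaves `a c' a' c`, the cycle of a coordinate plane. -/
theorem isFlatPlane_cone_three (hab : a.1 ≠ b.1) (hac : a.1 ≠ c.1) (hbc : b.1 ≠ c.1) :
    IsFlatPlane (cone [s(a, b), s(b, c), s(c, a)]) := by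
  have nab : a ≠ b := fun h => hab (by rw [h])
  have nac : a ≠ c := fun h => hac (by rw [h])
  have nbc : b ≠ c := fun h => hbc (by rw [h])
  have nab' : a.opp ≠ b := fun h => hab (by rw [← h, opp_fst])
  have nac' : a.opp ≠ c := fun h => hac (by rw [← h, opp_fst])
  have nca' : c.opp ≠ a := fun h => hac (by rw [← h, opp_fst])
  have ncb' : c.opp ≠ b := fun h => hbc (by rw [← h, opp_fst])
  have naa := opp_ne a
  have ncc := opp_ne c
  have nac'' : a.opp ≠ c.opp := fun h => hac (by rw [← opp_fst a, h, opp_fst])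
  rw [← isFlatPlane_cone_triangle_iff (c := c.opp) hab hac hbc
    (by simp; tauto) (by simp; tauto)]
  rw [cone_congr (es' := [s(c, b), s(a, c.opp), s(c.opp, b), s(c, a)])
    (fun e => by simp [Sym2.eq_swap (a := b) (b := c)]; tauto)]
  rw [← isFlatPlane_cone_triangle_iff (c := a.opp) hbc.symm hac.symm hab.symm
    (by simp; tauto) (by simp; tauto)]
  rw [cone_congr (es' := [s(a.opp, b), s(b, c.opp), s(c, a.opp), s(a, c.opp), s(c, a)])
    (fun e => by simp [Sym2.eq_swap (a := b) (b := c.opp)]; tauto)]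
  rw [isFlatPlane_cone_triangle_iff (c := b) (a := a.opp) (b := c.opp) hac hab hbc.symm
    (by simp; tauto) (by simp; tauto)]
  rw [cone_congr (es' := [s(a, c), s(c, a.opp), s(a.opp, c.opp), s(c.opp, a)])
    (fun e => by simp [Sym2.eq_swap (a := c) (b := a), Sym2.eq_swap (a := a) (b := c.opp)]; tauto)]
  exact isFlatPlane_cone_opp hac

theorem cone_swap (p q : Sym2 SignedAxis) (es : List (Sym2 SignedAxis)) :
    cone (p :: q :: es) = cone (q :: p :: es) :=
  cone_congr fun e => by simp only [List.mem_cons]; tauto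

theorem cone_rotate (p q r : Sym2 SignedAxis) (es : List (Sym2 SignedAxis)) :
    cone (p :: q :: r :: es) = cone (q :: r :: p :: es) :=
  cone_congr fun e => by simp only [List.mem_cons]; tauto

theorem cone_rotate_two (p q r s : Sym2 SignedAxis) (es : List (Sym2 SignedAxis)) :
    cone (p :: q :: r :: s :: es) = cone (r :: s :: p :: q :: es) :=
  cone_congr fun e => by simp only [List.mem_cons]; tauto

set_option maxHeartbeats 800000 in
open SimpleGraph in
/-- The cone over each cycle of quadrants is a flat plane. -/
theorem isFlatPlane_cone_of_isCycle {u : SignedAxis} (w : axisGraph.Walk u u) (hw : w.IsCycle) :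
    IsFlatPlane (cone w.edges) := by
  induction hn : w.length using Nat.strong_induction_on generalizing u with
  | _ n ih =>
  subst hn
  cases w with
  | nil => simp at hw
  | @cons _ c _ hac w₁ =>
  cases w₁ with
  | nil => exact absurd rfl hac
  | @cons _ b _ hcb w₂ =>
  cases w₂ with
  | nil => exact absurd hw.three_le_length (by simp)
  | @cons _ d _ hbd w₃ =>
  cases w₃ with
  | nil => simpa using isFlatPlane_cone_three hac hbd.symm hcb
  | @cons _ e _ hde w =>
  have hu : u ∈ w.support := w.end_mem_support
  have he : e ∈ w.support := w.start_mem_support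
  have hmem : ∀ x ∉ w.support, ∀ s ∈ w.edges, x ∉ s := fun x hx s hs hxs =>
    hx (Walk.mem_support_of_mem_edges hs hxs)
  have hedge : ∀ x ∉ w.support, ∀ y, s(x, y) ∉ w.edges ∧ s(y, x) ∉ w.edges := fun x hx y =>
    ⟨fun h => hmem x hx _ h (Sym2.mem_mk_left x y), fun h => hmem x hx _ h (Sym2.mem_mk_right y x)⟩
  have hpath := (Walk.cons_isCycle_iff _ _).1 hw
  simp only [Walk.cons_isPath_iff, Walk.support_cons, List.mem_cons, not_or] at hpath
  obtain ⟨⟨⟨⟨hwp, hdw⟩, hbd', hbw⟩, hcb', hcd', hcw⟩, -⟩ := hpath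
  have ne : ∀ x ∉ w.support, x ≠ u ∧ u ≠ x ∧ x ≠ e ∧ e ≠ x := fun x hx =>
    ⟨fun h => hx (h ▸ hu), fun h => hx (h ▸ hu), fun h => hx (h ▸ he), fun h => hx (h ▸ he)⟩
  obtain ⟨hcu, huc, hce, hec⟩ := ne c hcw
  obtain ⟨hbu, hub, hbe, heb⟩ := ne b hbw
  obtain ⟨hdu, hud, hde', hed⟩ := ne d hdw
  have hcE := hmem c hcw
  have hbE := hmem b hbw
  have hdE := hmem d hdw
  have huc' := (hedge c hcw u).2
  have hcd'' := (hedge c hcw d).1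
  have hub' := (hedge b hbw u).2
  have hbe' := (hedge b hbw e).1
  clear hmem hedge ne
  -- The cycle starts `u, c, b, d, e`. A chord `u b`, `c d` or `b e` cuts off a vertex; if the first
  -- two are missing, then `b = -u` and `d = -c`, and the third is missing only when `e = u`.
  by_cases hub1 : u.1 = b.1
  · obtain rfl := eq_opp_of_fst_eq hub1.symm hbu
    by_cases hcd1 : c.1 = d.1
    · obtain rfl := eq_opp_of_fst_eq hcd1.symm (Ne.symm hcd')
      by_cases heu : e = u
      · subst heu
        obtain rfl := (Walk.eq_nil_iff_nil.2 (Walk.isPath_iff_nil.1 hwp))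
        exact isFlatPlane_cone_opp hac
      · have hbe1 : axisGraph.Adj u.opp e := fun h => heu <| by
          rw [eq_opp_of_fst_eq h.symm heb, opp_opp]
        have hcyc : (Walk.cons hac (.cons hcb (.cons hbe1 w))).IsCycle := by
          simp only [Walk.cons_isCycle_iff, Walk.cons_isPath_iff, Walk.support_cons,
            List.mem_cons, Walk.edges_cons, Sym2.eq_iff]
          tauto
        have hflat := ih _ (by simp) _ hcyc rfl
        simp only [Walk.edges_cons] at hflat ⊢
        rw [← cone_rotate] at hflat
        rw [cone_rotate_two]
        refine (isFlatPlane_cone_triangle_iff hbe1 hbd (Ne.symm hde) ?_ ?_).2 hflat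
        · simp only [List.forall_mem_cons, Sym2.mem_iff]; tauto
        · simp only [List.mem_cons, Sym2.eq_iff]; tauto
    · have hcd2 : axisGraph.Adj c d := hcd1
      have hcyc : (Walk.cons hac (.cons hcd2 (.cons hde w))).IsCycle := by
        simp only [Walk.cons_isCycle_iff, Walk.cons_isPath_iff, Walk.support_cons,
          List.mem_cons, Walk.edges_cons, Sym2.eq_iff]
        tauto
      have hflat := ih _ (by simp) _ hcyc rfl
      simp only [Walk.edges_cons] at hflat ⊢
      rw [cone_swap] at hflat
      rw [cone_rotate]
      refine (isFlatPlane_cone_triangle_iff hcd2 hcb (Ne.symm hbd) ?_ ?_).2 hflat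
      · simp only [List.forall_mem_cons, Sym2.mem_iff]; tauto
      · simp only [List.mem_cons, Sym2.eq_iff]; tauto
  · have hub2 : axisGraph.Adj u b := hub1
    have hcyc : (Walk.cons hub2 (.cons hbd (.cons hde w))).IsCycle := by
      simp only [Walk.cons_isCycle_iff, Walk.cons_isPath_iff, Walk.support_cons,
        List.mem_cons, Walk.edges_cons, Sym2.eq_iff]
      tauto
    have hflat := ih _ (by simp) _ hcyc rfl
    simp only [Walk.edges_cons] at hflat ⊢
    refine (isFlatPlane_cone_triangle_iff hub1 hac (Ne.symm hcb) ?_ ?_).2 hflat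
    · simp only [List.forall_mem_cons, Sym2.mem_iff]; tauto
    · simp only [List.mem_cons, Sym2.eq_iff]; tauto

end SignedAxis

/-! ### Cycles in finite graphs -/

/-- A nonempty finite graph without leaves has a cycle. -/
theorem SimpleGraph.exists_isCycle_of_forall_exists_ne {V : Type*} [Finite V] {G : SimpleGraph V}
    (hne : ∃ a b, G.Adj a b) (h : ∀ a b, G.Adj a b → ∃ c, c ≠ b ∧ G.Adj a c) :
    ∃ (u : V) (w : G.Walk u u), w.IsCycle := by
  by_contra! hcyc
  have hG : G.IsAcyclic := fun u w hw => hcyc u w hw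
  have : Nonempty V := ⟨hne.choose⟩
  -- A second neighbour of the start of a longest path either lies on the path, which closes a
  -- cycle, or extends it.
  obtain ⟨u, v, p, hp, hmax⟩ := Walk.exists_isPath_forall_isPath_length_le_length G
  have hnil : ¬ p.Nil := by
    obtain ⟨a, b, hab⟩ := hne
    have h1 := hmax a b hab.toWalk (by simp [hab.ne])
    intro hnil
    rw [Walk.length_eq_zero_iff.2 hnil] at h1
    simp at h1
  obtain ⟨c, hc, huc⟩ := h _ _ (p.adj_snd hnil)
  refine hc (hG.eq_snd_of_adj_start hp huc ?_)
  by_contra hcp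
  have h1 := hmax _ _ (p.cons huc.symm) (hp.cons hcp)
  simp at h1

open Topology in
theorem exists_pos_of_eventually_nhds {E : Type*} [AddCommGroup E] [Module ℝ E]
    [TopologicalSpace E] [IsTopologicalAddGroup E] [ContinuousSMul ℝ E] {P : E → Prop} {q : E}
    (h : ∀ᶠ x in 𝓝 q, P x) (v : E) : ∃ t : ℝ, 0 < t ∧ P (q + t • v) := by
  have h1 : Filter.Tendsto (fun t : ℝ => q + t • v) (𝓝[>] 0) (𝓝 q) := by
    have : Filter.Tendsto (fun t : ℝ => q + t • v) (𝓝 0) (𝓝 (q + (0 : ℝ) • v)) :=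
      Continuous.tendsto (by fun_prop) 0
    rw [zero_smul, add_zero] at this
    exact this.mono_left nhdsWithin_le_nhds
  exact ((h1.eventually h).and self_mem_nhdsWithin).exists.imp fun t ht => ⟨ht.2, ht.1⟩

/-! ### The 2-skeleton in the open cube -/

/-- The fixed coordinates of a face are integers, and `0` is the only integer in `(-1, 1)`. -/
theorem exists_pair_of_mem_cubicalSkeleton {x : EuclideanSpace ℝ (Fin 4)}
    (hx : x ∈ cubicalSkeleton 4 2) (h1 : ∀ i, |x i| < 1) :
    ∃ i j : Fin 4, i ≠ j ∧ ∀ k, k ≠ i → k ≠ j → x k = 0 := by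
  obtain ⟨k, hk, F, ⟨z, S, rfl, rfl⟩, hxF⟩ := hx
  obtain ⟨T, hST, hT⟩ := Finset.exists_superset_card_eq hk (by simp)
  obtain ⟨i, j, hij, rfl⟩ := Finset.card_eq_two.1 hT
  refine ⟨i, j, hij, fun k hki hkj => ?_⟩
  have hkS : k ∉ S := fun h => by simpa [hki, hkj] using hST h
  have h2 : |(z k : ℝ)| < 1 := by rw [← hxF.2 k hkS]; exact h1 k
  rw [hxF.2 k hkS]
  have h3 : -1 < z k := by exact_mod_cast (abs_lt.1 h2).1
  have h4 : z k < 1 := by exact_mod_cast (abs_lt.1 h2).2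
  rw [show z k = 0 by omega, Int.cast_zero]

theorem mem_starAtZero_of_mem_cubicalSkeleton {x : EuclideanSpace ℝ (Fin 4)}
    (hx : x ∈ cubicalSkeleton 4 2) (h1 : ∀ i, |x i| < 1) : x ∈ starAtZero := by
  obtain ⟨i, j, hij, h0⟩ := exists_pair_of_mem_cubicalSkeleton hx h1
  -- Rounding so that the face lies on the same side of `0` as `x` puts both points in it.
  let z : Fin 4 → ℤ := fun k => if x k < 0 then -1 else 0
  have hz : ∀ k, x k < 0 ∧ (z k : ℝ) = -1 ∨ 0 ≤ x k ∧ (z k : ℝ) = 0 := by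
    intro k
    rcases lt_or_ge (x k) 0 with h | h
    · exact Or.inl ⟨h, by simp [z, h]⟩
    · exact Or.inr ⟨h, by simp [z, h.not_gt]⟩
  have hz0 : ∀ k ∉ ({i, j} : Finset (Fin 4)), x k = 0 ∧ (z k : ℝ) = 0 := by
    intro k hk
    simp only [Finset.mem_insert, Finset.mem_singleton, not_or] at hk
    have := h0 k hk.1 hk.2
    exact ⟨this, by simp [z, this]⟩
  refine ⟨_, ⟨z, {i, j}, Finset.card_pair hij, rfl⟩, ⟨fun k _ => ?_, fun k hk => ?_⟩,
    fun k _ => ?_, fun k hk => ?_⟩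
  · rcases hz k with h | h <;> rw [h.2] <;> simp
  · simp [(hz0 k hk).2]
  · have := abs_lt.1 (h1 k)
    rcases hz k with h | h <;> rw [h.2] <;> constructor <;> linarith
  · rw [(hz0 k hk).1, (hz0 k hk).2]

/-! ### The quadrants met by a surface -/

namespace SignedAxis

variable {a b c : SignedAxis} {N U : Set (EuclideanSpace ℝ (Fin 4))}

/-- The open quadrant spanned by two signed axes. -/
def openQuadrant (a b : SignedAxis) : Set (EuclideanSpace ℝ (Fin 4)) :=
  {x | 0 < a.coord x ∧ 0 < b.coord x ∧ ∀ i, i ≠ a.1 → i ≠ b.1 → x i = 0}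

theorem openQuadrant_comm (a b : SignedAxis) : openQuadrant a b = openQuadrant b a := by
  ext x
  exact ⟨fun h => ⟨h.2.1, h.1, fun i hi hj => h.2.2 i hj hi⟩,
    fun h => ⟨h.2.1, h.1, fun i hi hj => h.2.2 i hj hi⟩⟩

theorem convex_openQuadrant (a b : SignedAxis) : Convex ℝ (openQuadrant a b) := by
  intro x hx y hy s t hs ht hst
  have hpos : ∀ {u v : ℝ}, 0 < u → 0 < v → 0 < s * u + t * v := fun {u v} hu hv => by
    rcases hs.eq_or_lt with rfl | hs
    · have : t = 1 := by linarith
      simpa [this] using hv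
    · positivity
  refine ⟨?_, ?_, fun i hia hib => ?_⟩
  · simpa using hpos hx.1 hy.1
  · simpa using hpos hx.2.1 hy.2.1
  · simp [hx.2.2 i hia hib, hy.2.2 i hia hib]

theorem ne_zero_of_coord_pos {x : EuclideanSpace ℝ (Fin 4)} (h : 0 < a.coord x) : x a.1 ≠ 0 :=
  fun h0 => h.ne' ((coord_eq_zero_iff a x).2 h0)

/-- The pairs of signed axes whose open quadrant meets `N` inside `U`. -/
def quadrantGraph (N U : Set (EuclideanSpace ℝ (Fin 4))) : SimpleGraph SignedAxis where
  Adj a b := a.1 ≠ b.1 ∧ (N ∩ openQuadrant a b ∩ U).Nonempty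
  symm := ⟨fun a b h => ⟨h.1.symm, by rw [openQuadrant_comm]; exact h.2⟩⟩
  loopless := ⟨fun _ h => h.1 rfl⟩

theorem apply_eq_zero_of_mem_skeleton {x : EuclideanSpace ℝ (Fin 4)}
    (hx : x ∈ cubicalSkeleton 4 2) (h1 : ∀ i, |x i| < 1) {k l : Fin 4} (hkl : k ≠ l)
    (hk : x k ≠ 0) (hl : x l ≠ 0) : ∀ m, m ≠ k → m ≠ l → x m = 0 := by
  obtain ⟨i, j, -, h0⟩ := exists_pair_of_mem_cubicalSkeleton hx h1
  intro m hmk hml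
  refine h0 m ?_ ?_
  · rintro rfl
    have : k = j := by by_contra h; exact hk (h0 k hmk.symm h)
    have : l = j := by by_contra h; exact hl (h0 l hml.symm h)
    simp_all
  · rintro rfl
    have : k = i := by by_contra h; exact hk (h0 k h hmk.symm)
    have : l = i := by by_contra h; exact hl (h0 l h hml.symm)
    simp_all

variable [ChartedSpace (EuclideanSpace ℝ (Fin 2)) N]

-- Near `q` the 2-skeleton lies in the plane of coordinates `k`, `l`, so invariance of domain makes
-- `N` fill it.
open Topology in
theorem eventually_mem_of_apply_ne_zero (hsub : N ⊆ cubicalSkeleton 4 2)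
    {q : EuclideanSpace ℝ (Fin 4)} (hq : q ∈ N) (hq1 : ∀ᶠ x in 𝓝 q, ∀ i, |x i| < 1)
    {k l : Fin 4} (hkl : k ≠ l) (hk : q k ≠ 0) (hl : q l ≠ 0) :
    ∀ᶠ x in 𝓝 q, x ∈ {x : EuclideanSpace ℝ (Fin 4) | ∀ m, m ≠ k → m ≠ l → x m = 0} → x ∈ N := by
  refine (isFlatPlane_coordinatePlane hkl).eventually_mem_of_surface_subset hq ?_
  have hc : ∀ i : Fin 4, Continuous fun x : EuclideanSpace ℝ (Fin 4) => x i := fun i => by fun_prop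
  filter_upwards [hq1, (hc k).continuousAt.eventually_ne hk, (hc l).continuousAt.eventually_ne hl]
    with x h1 hxk hxl hxN
  exact apply_eq_zero_of_mem_skeleton (hsub hxN) h1 hkl hxk hxl

-- Within the convex set `openQuadrant a b ∩ U`, the part in `N` is open by invariance of domain and
-- closed by `hcl`.
open Topology in
theorem openQuadrant_inter_subset (hsub : N ⊆ cubicalSkeleton 4 2) (hU : IsOpen U)
    (hUc : Convex ℝ U) (hcl : U ∩ closure N ⊆ N) (hU1 : ∀ x ∈ U, ∀ i, |x i| < 1)
    (h : (quadrantGraph N U).Adj a b) : openQuadrant a b ∩ U ⊆ N := by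
  obtain ⟨hab, y, ⟨hyN, hyQ⟩, hyU⟩ := h
  intro x hx
  by_contra hxN
  have hxc : x ∉ closure N := fun h => hxN (hcl ⟨hx.2, h⟩)
  let P : Set (EuclideanSpace ℝ (Fin 4)) := {x | ∀ m, m ≠ a.1 → m ≠ b.1 → x m = 0}
  have hpre : IsPreconnected (openQuadrant a b ∩ U) :=
    ((convex_openQuadrant a b).inter hUc).isPreconnected
  have hin : ∀ z ∈ openQuadrant a b ∩ U, z ∈ N → ∀ᶠ x in 𝓝 z, x ∈ P → x ∈ N := fun z hz hzN =>
    eventually_mem_of_apply_ne_zero hsub hzN ((hU.eventually_mem hz.2).mono hU1) hab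
      (ne_zero_of_coord_pos hz.1.1) (ne_zero_of_coord_pos hz.1.2.1)
  obtain ⟨z, hz, hz1, hz2⟩ := hpre {z | ∀ᶠ x in 𝓝 z, x ∈ P → x ∈ N} (closure N)ᶜ
    isOpen_setOfPred_eventually_nhds isClosed_closure.isOpen_compl
    (fun z hz => by
      by_cases hzN : z ∈ closure N
      · exact Or.inl (hin z hz (hcl ⟨hz.2, hzN⟩))
      · exact Or.inr hzN)
    ⟨y, ⟨hyQ, hyU⟩, hin y ⟨hyQ, hyU⟩ hyN⟩ ⟨x, hx, hxc⟩
  exact hz2 (subset_closure ((hz1 : ∀ᶠ x in 𝓝 z, x ∈ P → x ∈ N).self_of_nhds hz.1.2.2))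

open Topology in
theorem quadrant_inter_subset (hsub : N ⊆ cubicalSkeleton 4 2) (hU : IsOpen U)
    (hUc : Convex ℝ U) (hcl : U ∩ closure N ⊆ N) (hU1 : ∀ x ∈ U, ∀ i, |x i| < 1)
    (h : (quadrantGraph N U).Adj a b) : quadrant a b ∩ U ⊆ N := by
  intro x hx
  refine hcl ⟨hx.2, mem_closure_iff_nhds.2 fun V hV => ?_⟩
  obtain ⟨t, ht, htV, htU⟩ := exists_pos_of_eventually_nhds
    (Filter.inter_mem hV (hU.mem_nhds hx.2)) (a.unit + b.unit)
  refine ⟨_, htV, openQuadrant_inter_subset hsub hU hUc hcl hU1 h ⟨⟨?_, ?_, ?_⟩, htU⟩⟩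
  · have := hx.1.1
    simp only [map_add, map_smul, coord_unit_self, coord_unit_of_ne h.1, smul_eq_mul]
    linarith
  · have := hx.1.2.1
    simp only [map_add, map_smul, coord_unit_self, coord_unit_of_ne h.1.symm, smul_eq_mul]
    linarith
  · intro i hia hib
    simp [hx.1.2.2 i hia hib, unit_apply, hia, hib]

open Topology in
/-- Near a point of an open half-axis, a surface in the 2-skeleton has at least two quadrants. -/
theorem exists_ne_quadrantGraph_adj (hsub : N ⊆ cubicalSkeleton 4 2) (hU : IsOpen U)
    (hU1 : ∀ x ∈ U, ∀ i, |x i| < 1) {q : EuclideanSpace ℝ (Fin 4)} (hqN : q ∈ N) (hqU : q ∈ U)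
    (hqa : 0 < a.coord q) (hq0 : ∀ k, k ≠ a.1 → q k = 0) (hab : a.1 ≠ b.1) :
    ∃ c, c ≠ b ∧ (quadrantGraph N U).Adj a c := by
  by_contra! hne
  have h1 : ∀ᶠ x in 𝓝 q, 0 < a.coord x :=
    a.coord.continuous.continuousAt.eventually (lt_mem_nhds hqa)
  -- If no quadrant at `a` other than that of `a, b` occurred, `N` would lie in the plane of `a, b`
  -- near `q`, hence fill it, and so enter the quadrant of `a, b.opp`.
  have h2 := (isFlatPlane_coordinatePlane hab).eventually_mem_of_surface_subset hqN (by
    filter_upwards [h1, hU.mem_nhds hqU] with x hxa hxU hxN k hka hkb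
    by_contra hk
    obtain ⟨c, rfl, hc⟩ := exists_coord_pos hk
    exact hne c (fun h => hkb (by rw [h])) ⟨hka.symm, x, ⟨hxN, hxa, hc,
      apply_eq_zero_of_mem_skeleton (hsub hxN) (hU1 x hxU) hka.symm (ne_zero_of_coord_pos hxa) hk⟩,
      hxU⟩)
  obtain ⟨t, ht, htN, htU⟩ := exists_pos_of_eventually_nhds
    (h2.and (hU.mem_nhds hqU)) b.opp.unit
  have hab' : a.1 ≠ b.opp.1 := hab
  have h0 : ∀ k, k ≠ a.1 → k ≠ b.1 → (q + t • b.opp.unit) k = 0 := fun k hka hkb => by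
    simp [hq0 k hka, unit_apply, hkb]
  refine hne b.opp (opp_ne b) ⟨hab, _, ⟨htN h0, ?_, ?_, h0⟩, htU⟩
  · simpa [coord_unit_of_ne hab'] using hqa
  · have : b.opp.coord q = 0 := (coord_eq_zero_iff _ _).2 (hq0 _ hab.symm)
    simpa [this] using ht

end SignedAxis

/-! ### Flat germs of surfaces in the 2-skeleton -/

section

open SignedAxis

variable {N : Set (EuclideanSpace ℝ (Fin 4))} [ChartedSpace (EuclideanSpace ℝ (Fin 2)) N]
  {p : EuclideanSpace ℝ (Fin 4)}

open Topology in
theorem exists_ball_surface_inter_closure_subset (hp : p ∈ N)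
    {P : EuclideanSpace ℝ (Fin 4) → Prop} (hP : ∀ᶠ x in 𝓝 p, P x) :
    ∃ r > 0, Metric.ball p r ∩ closure N ⊆ N ∧ ∀ x ∈ Metric.ball p r, P x := by
  have := ChartedSpace.locallyCompactSpace (EuclideanSpace ℝ (Fin 2)) N
  obtain ⟨r, hr, hrN⟩ := exists_ball_inter_closure_subset hp
  obtain ⟨s, hs, hsP⟩ := Metric.eventually_nhds_iff_ball.1 hP
  refine ⟨min r s, lt_min hr hs, fun x hx => hrN ⟨?_, hx.2⟩, fun x hx => hsP x ?_⟩
  · exact Metric.ball_subset_ball (min_le_left r s) hx.1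
  · exact Metric.ball_subset_ball (min_le_right r s) hx

open Topology in
theorem hasFlatGerm_of_two_ne_zero (hsub : N ⊆ cubicalSkeleton 4 2) (hp : p ∈ N)
    (hp1 : ∀ᶠ x in 𝓝 p, ∀ i, |x i| < 1) {k l : Fin 4} (hkl : k ≠ l) (hk : p k ≠ 0)
    (hl : p l ≠ 0) : HasFlatGerm N p :=
  (isFlatPlane_coordinatePlane hkl).hasFlatGerm_of_subset_surface hp
    (apply_eq_zero_of_mem_skeleton (hsub hp) hp1.self_of_nhds hkl hk hl)
    (eventually_mem_of_apply_ne_zero hsub hp hp1 hkl hk hl)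

-- Two quadrants of `N` meet along the half-axis through `p`. Near `p` they form a coordinate plane
-- or a bent one, and invariance of domain excludes any further quadrant.
open Topology in
theorem hasFlatGerm_of_mem_axis (hsub : N ⊆ cubicalSkeleton 4 2) (hp : p ∈ N)
    (hp1 : ∀ᶠ x in 𝓝 p, ∀ i, |x i| < 1) {k : Fin 4} (hk : p k ≠ 0)
    (hk0 : ∀ l, l ≠ k → p l = 0) : HasFlatGerm N p := by
  obtain ⟨a, rfl, ha⟩ := exists_coord_pos hk
  have ha' : ∀ᶠ x in 𝓝 p, 0 < a.coord x :=
    a.coord.continuous.continuousAt.eventually (lt_mem_nhds ha)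
  obtain ⟨r, hr, hcl, hU⟩ := exists_ball_surface_inter_closure_subset hp (hp1.and ha')
  have hpU : p ∈ Metric.ball p r := Metric.mem_ball_self hr
  have hUN := Metric.isOpen_ball.eventually_mem hpU
  have hU1 : ∀ x ∈ Metric.ball p r, ∀ i, |x i| < 1 := fun x hx => (hU x hx).1
  obtain ⟨i, hi⟩ := exists_ne a.1
  have hadj : ∀ {b : SignedAxis}, a.1 ≠ b.1 → _ := fun {b} =>
    exists_ne_quadrantGraph_adj hsub Metric.isOpen_ball hU1 hp hpU ha hk0
  have hquad : ∀ {b}, (quadrantGraph N (Metric.ball p r)).Adj a b →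
      quadrant a b ∩ Metric.ball p r ⊆ N := fun h =>
    quadrant_inter_subset hsub Metric.isOpen_ball (convex_ball p r) hcl hU1 h
  obtain ⟨b, -, hb⟩ := hadj (b := (i, true)) hi.symm
  obtain ⟨c, hcb, hc⟩ := hadj hb.1
  by_cases hbc : c.1 = b.1
  · obtain rfl := eq_opp_of_fst_eq hbc hcb
    refine (isFlatPlane_coordinatePlane hb.1).hasFlatGerm_of_subset_surface hp
      (fun m hm _ => hk0 m hm) ?_
    filter_upwards [hUN] with x hxU hx
    rcases le_total 0 (b.coord x) with h | h
    · exact hquad hb ⟨⟨(hU x hxU).2.le, h, hx⟩, hxU⟩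
    · exact hquad hc ⟨⟨(hU x hxU).2.le, by rw [coord_opp]; linarith, hx⟩, hxU⟩
  -- The third quadrant, of `b, c`, completes a flat plane but stays away from `p`, since the
  -- coordinate along `a` vanishes on it.
  · refine (isFlatPlane_cone_three hb.1 hc.1 (Ne.symm hbc)).hasFlatGerm_of_subset_surface hp
      ⟨a, b, by simp, ha.le, ((coord_eq_zero_iff _ _).2 (hk0 _ hb.1.symm)).ge,
        fun m hm _ => hk0 m hm⟩ ?_
    filter_upwards [hUN] with x hxU hx
    rw [cone_cons, cone_cons, cone_cons] at hx
    rcases hx with ((⟨_, _, h, -⟩ | hx) | hx) | hx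
    · simp at h
    · exact hquad hc ⟨by rwa [quadrant_comm], hxU⟩
    · exact absurd (hx.2.2 a.1 hb.1 hc.1) (ne_zero_of_coord_pos (hU x hxU).2)
    · exact hquad hb ⟨hx, hxU⟩

-- By invariance of domain `0` is not isolated in `N`. A nearby nonzero point of `N` lies in an open
-- quadrant or on a half-axis, where quadrants of `N` meet.
open Topology in
theorem exists_quadrantGraph_adj_of_zero_mem (hsub : N ⊆ cubicalSkeleton 4 2)
    {U : Set (EuclideanSpace ℝ (Fin 4))} (hU : IsOpen U)
    (hU1 : ∀ x ∈ U, ∀ i, |x i| < 1) (h0 : 0 ∈ N) (h0U : 0 ∈ U) :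
    ∃ a b, (quadrantGraph N U).Adj a b := by
  obtain ⟨q, hqN, hqU, hq⟩ : ∃ q ∈ N, q ∈ U ∧ q ≠ 0 := by
    by_contra! h
    have h1 := (isFlatPlane_coordinatePlane (i := 0) (j := 1)
      (by decide)).eventually_mem_of_surface_subset h0 (by
        filter_upwards [hU.mem_nhds h0U] with x hxU hxN k _ _
        simp [h x hxN hxU])
    let a : SignedAxis := (0, true)
    obtain ⟨t, ht, htN, htU⟩ := exists_pos_of_eventually_nhds (h1.and (hU.mem_nhds h0U)) a.unit
    have h2 := h _ (htN fun k hk _ => by simp [unit_apply, a, hk]) htU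
    have h3 := congr_arg a.coord h2
    simp [ht.ne'] at h3
  obtain ⟨k, hk⟩ : ∃ k, q k ≠ 0 := by
    by_contra! h
    exact hq (by ext k; simp [h])
  obtain ⟨a, rfl, ha⟩ := exists_coord_pos hk
  by_cases hq2 : ∃ l, l ≠ a.1 ∧ q l ≠ 0
  · obtain ⟨l, hla, hl⟩ := hq2
    obtain ⟨b, rfl, hb⟩ := exists_coord_pos hl
    exact ⟨a, b, hla.symm, q, ⟨hqN, ha, hb,
      apply_eq_zero_of_mem_skeleton (hsub hqN) (hU1 q hqU) hla.symm hk hl⟩, hqU⟩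
  · push Not at hq2
    obtain ⟨i, hi⟩ := exists_ne a.1
    obtain ⟨b, -, hb⟩ := exists_ne_quadrantGraph_adj (b := (i, true)) hsub hU hU1 hqN hqU ha hq2
      hi.symm
    exact ⟨a, b, hb⟩

-- Each edge at `a` puts the start of the half-axis `a` into `N`, and a point there yields a second
-- edge at `a`. So there is a cycle, and its cone is a flat plane contained in `N` near `0`.
open Topology SimpleGraph in
theorem hasFlatGerm_zero (hsub : N ⊆ cubicalSkeleton 4 2) (h0 : 0 ∈ N)
    (hp1 : ∀ᶠ x in 𝓝 (0 : EuclideanSpace ℝ (Fin 4)), ∀ i, |x i| < 1) :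
    HasFlatGerm N 0 := by
  obtain ⟨r, hr, hcl, hU1⟩ := exists_ball_surface_inter_closure_subset h0 hp1
  have h0U : (0 : EuclideanSpace ℝ (Fin 4)) ∈ Metric.ball 0 r := Metric.mem_ball_self hr
  have hUN := Metric.isOpen_ball.eventually_mem h0U
  have hquad : ∀ {a b}, (quadrantGraph N (Metric.ball 0 r)).Adj a b →
      quadrant a b ∩ Metric.ball 0 r ⊆ N := fun h =>
    quadrant_inter_subset hsub Metric.isOpen_ball (convex_ball 0 r) hcl hU1 h
  obtain ⟨u, w, hw⟩ := exists_isCycle_of_forall_exists_ne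
    (exists_quadrantGraph_adj_of_zero_mem hsub Metric.isOpen_ball hU1 h0 h0U) (by
      intro a b hab
      obtain ⟨t, ht, htU⟩ := exists_pos_of_eventually_nhds hUN a.unit
      rw [zero_add] at htU
      refine exists_ne_quadrantGraph_adj hsub Metric.isOpen_ball hU1 (hquad hab ⟨?_, htU⟩) htU
        (by simpa using ht) (fun k hk => by simp [unit_apply, hk]) hab.1
      exact (mem_quadrant_iff hab.1).2 ⟨t, 0, ht.le, le_rfl, by simp⟩)
  have hle : quadrantGraph N (Metric.ball 0 r) ≤ axisGraph := fun a b h => h.1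
  have hflat := isFlatPlane_cone_of_isCycle (w.mapLe hle) ((Walk.isCycle_mapLe hle).2 hw)
  rw [Walk.edges_mapLe_eq_edges] at hflat
  refine hflat.hasFlatGerm_of_subset_surface h0 ?_ ?_
  · cases w with
    | nil => simp at hw
    | cons h w => exact ⟨_, _, List.mem_cons_self, by simp [quadrant]⟩
  · filter_upwards [hUN] with x hxU hx
    obtain ⟨a, b, hab, hx⟩ := hx
    exact hquad (w.adj_of_mem_edges hab) ⟨hx, hxU⟩

open Topology in
theorem eventually_forall_abs_lt_one {x : EuclideanSpace ℝ (Fin 4)} (h : ∀ i, |x i| < 1) :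
    ∀ᶠ y in 𝓝 x, ∀ i, |y i| < 1 := by
  refine Filter.eventually_all.2 fun i => ?_
  have : Continuous fun y : EuclideanSpace ℝ (Fin 4) => |y i| := by fun_prop
  exact this.continuousAt.eventually (gt_mem_nhds (h i))

/-- A surface in the 2-skeleton has a flat germ at its points in the open cube around `0`. -/
theorem hasFlatGerm_of_mem_openCube (hsub : N ⊆ cubicalSkeleton 4 2) (hp : p ∈ N)
    (h : ∀ i, |p i| < 1) : HasFlatGerm N p := by
  have hp1 := eventually_forall_abs_lt_one h
  by_cases hp0 : ∃ k, p k ≠ 0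
  · obtain ⟨k, hk⟩ := hp0
    by_cases hp2 : ∃ l, l ≠ k ∧ p l ≠ 0
    · obtain ⟨l, hlk, hl⟩ := hp2
      exact hasFlatGerm_of_two_ne_zero hsub hp hp1 hlk.symm hk hl
    · push Not at hp2
      exact hasFlatGerm_of_mem_axis hsub hp hp1 hk hp2
  · push Not at hp0
    obtain rfl : p = 0 := by ext k; simp [hp0]
    exact hasFlatGerm_zero hsub hp hp1

open Topology in
theorem HasFlatGerm.congr {M M' : Set (EuclideanSpace ℝ (Fin 4))} (h : HasFlatGerm M p)
    (hM : ∀ᶠ x in 𝓝 p, x ∈ M' ↔ x ∈ M) : HasFlatGerm M' p := by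
  obtain ⟨X, hX, h⟩ := h
  exact ⟨X, hX, by filter_upwards [h, hM] with x h1 h2 using h2.trans h1⟩

end

theorem mainTheorem4 (N : Set (EuclideanSpace ℝ (Fin 4))) (hN : IsGriddedSurface N)
    (h0 : (0 : EuclideanSpace ℝ (Fin 4)) ∈ N) :
    IsLocallyFlatAt 2 (squaredStar N) 0 ∧ IsLocallyFlatAt 2 N 0 ∧
      ∀ x ∈ squaredStar N, (∀ i, |x i| < 1) → IsLocallyFlatAt 2 (squaredStar N) x := by
  obtain ⟨⟨hchart⟩, hsub⟩ := hN
  have hstar : ∀ x, (∀ i, |x i| < 1) → (x ∈ squaredStar N ↔ x ∈ N) := fun x hx =>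
    ⟨fun h => h.1, fun h => ⟨h, mem_starAtZero_of_mem_cubicalSkeleton (hsub h) hx⟩⟩
  have hflat : ∀ x ∈ N, (∀ i, |x i| < 1) → IsLocallyFlatAt 2 (squaredStar N) x := fun x hxN hx =>
    ((hasFlatGerm_of_mem_openCube hsub hxN hx).congr
      ((eventually_forall_abs_lt_one hx).mono hstar)).isLocallyFlatAt ((hstar x hx).2 hxN)
  have h01 : ∀ i, |(0 : EuclideanSpace ℝ (Fin 4)) i| < 1 := by simp
  exact ⟨hflat 0 h0 h01, (hasFlatGerm_of_mem_openCube hsub h0 h01).isLocallyFlatAt h0,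
    fun x hx => hflat x hx.1⟩
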